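/- Let $d \ge 0$ and let $\mathcal A$ be a $*$-subalgebra of $\mathcal B(\mathbb C^d) = M_d(\mathbb C)$, that is, a complex linear subspace closed under matrix multiplication and under the adjoint $A \mapsto A^\dagger$ (it need not contain the identity matrix). Then there are integers $N \ge 0$, $d_0 \ge 0$ and $m_1,\dots,m_N, n_1,\dots,n_N \ge 1$ with $\sum_{i=1}^N n_i m_i + d_0 = d$, and a unitary matrix $U \in M_d(\mathbb C)$, such that $$U \mathcal A U^\dagger = \Bigl[\bigoplus_{i=1}^N \mathbb 1_{m_i} \otimes M_{n_i}(\mathbb C)\Bigr] \oplus 0_{d_0},$$ where the right-hand side is the set of all block diagonal $d \times d$ matrices with diagonal blocks $\mathbb 1_{m_1}\otimes X_1, \dots, \mathbb 1_{m_N} \otimes X_N, 0_{d_0}$, the $X_i \in M_{n_i}(\mathbb C)$ being arbitrary, $\otimes$ is the Kronecker product, $\mathbb 1_{m}$ is the $m\times m$ identity matrix and $0_{d_0}$ is the $d_0 \times d_0$ zero matrix. Moreover, for every such decomposition of $\mathcal A$ (even if some of the $m_i$, $n_i$ are allowed to be $0$), the center $\mathcal Z(\mathcal A) = \{A \in \mathcal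 A : AB = BA \text{ for all } B \in \mathcal A\}$ is the set of all matrices $$U^\dagger \Bigl(\Bigl[\bigoplus_{i=1}^N \alpha_i\, \mathbb 1_{m_i} \otimes \mathbb 1_{n_i}\Bigr] \oplus 0_{d_0}\Bigr) U, \qquad \alpha_1, \dots, \alpha_N \in \mathbb C.$$ -/

import Mathlib

open scoped Matrix Kronecker

/-- The ordering of the coordinates in the block form: the blocks `0, …, N - 1` in this order, block
`i` being indexed by `Fin (m i) × Fin (n i)` in lexicographic order (the usual ordering for the
Kronecker product), followed by the `d₀` coordinates of the zero block. -/
def blockIndexEquiv {d N d₀ : ℕ} (m n : Fin N → ℕ) (hd : ∑ i, n i * m i + d₀ = d) :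
    (Σ i : Fin N, Fin (m i) × Fin (n i)) ⊕ Fin d₀ ≃ Fin d :=
  (Equiv.sumCongr
      ((Equiv.sigmaCongrRight fun _ => finProdFinEquiv).trans finSigmaFinEquiv)
      (Equiv.refl (Fin d₀))).trans
    (finSumFinEquiv.trans (finCongr (by simpa only [mul_comm] using hd)))

/-- The `d × d` block diagonal matrix
`(1_{m_0} ⊗ X_0) ⊕ ⋯ ⊕ (1_{m_{N-1}} ⊗ X_{N-1}) ⊕ 0_{d₀}`. -/
def blockSum {d N d₀ : ℕ} (m n : Fin N → ℕ) (hd : ∑ i, n i * m i + d₀ = d)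
    (X : (i : Fin N) → Matrix (Fin (n i)) (Fin (n i)) ℂ) : Matrix (Fin d) (Fin d) ℂ :=
  Matrix.reindex (blockIndexEquiv m n hd) (blockIndexEquiv m n hd)
    (Matrix.fromBlocks
      (Matrix.blockDiagonal' fun i => (1 : Matrix (Fin (m i)) (Fin (m i)) ℂ) ⊗ₖ X i) 0
      0 (0 : Matrix (Fin d₀) (Fin d₀) ℂ))

/-- `U 𝒜 U† = [⨁ i, 1_{m_i} ⊗ M_{n_i}(ℂ)] ⊕ 0_{d₀}`, as sets of matrices. -/
def IsBlockDecomposition {d N d₀ : ℕ}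
    (𝒜 : NonUnitalStarSubalgebra ℂ (Matrix (Fin d) (Fin d) ℂ))
    (U : Matrix.unitaryGroup (Fin d) ℂ) (m n : Fin N → ℕ)
    (hd : ∑ i, n i * m i + d₀ = d) : Prop :=
  (fun A : Matrix (Fin d) (Fin d) ℂ => (U : Matrix (Fin d) (Fin d) ℂ) * A *
      (U : Matrix (Fin d) (Fin d) ℂ)ᴴ) '' (𝒜 : Set (Matrix (Fin d) (Fin d) ℂ)) =
    Set.range (blockSum m n hd)

/-- The center of the algebra `𝒜` itself: the elements of `𝒜` that commute with all of `𝒜`. -/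
def algebraCenter {d : ℕ} (𝒜 : NonUnitalStarSubalgebra ℂ (Matrix (Fin d) (Fin d) ℂ)) :
    Set (Matrix (Fin d) (Fin d) ℂ) :=
  {A | A ∈ 𝒜 ∧ ∀ B ∈ 𝒜, A * B = B * A}

/-! ### Orthonormal families and ranks of matrices. -/

namespace Matrix

/-! A nonzero `𝒜` contains a projection `p ≠ 0` with `p𝒜p = ℂp`, built from a nonzero element of
least rank (`exists_minimal_projection`). Then `y†z` is a multiple of `p` for `y, z` in the left
ideal `𝒜p`, which makes `𝒜p` a Hilbert space. For an orthonormal basis `x_k` of it, the products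
`x_k x_l†` are matrix units and `q = ∑ x_k x_k†` is a central projection of `𝒜`; since `x_k† a x_l ∈
ℂp`, the ideal `q𝒜` is the span of these units, a full matrix algebra. The elements of `𝒜` killed by
`q` form a `*`-algebra of smaller dimension, so induction gives matrix units spanning `𝒜`
(`exists_matrixUnits`).

If `v_j` is an orthonormal basis of the range of `p`, the vectors `x_k v_j`, over all blocks, are
orthonormal. A unitary sending them to standard basis vectors turns `x_k x_l†` into `1 ⊗ E_kl` in
its block. So `n_i` is the dimension of the left ideal and `m_i` the rank of the projection.

The center is computed blockwise: a matrix commuting with all matrices of its size is scalar. -/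

theorem exists_orthonormal_expansion {d : ℕ} (W : Submodule ℂ (Fin d → ℂ)) :
    ∃ (n : ℕ) (b : Fin n → Fin d → ℂ), (∀ k, b k ∈ W) ∧
      (∀ k l, star (b k) ⬝ᵥ b l = if k = l then 1 else 0) ∧
      ∀ w ∈ W, w = ∑ k, (star (b k) ⬝ᵥ w) • b k := by
  let e := (WithLp.linearEquiv 2 ℂ (Fin d → ℂ))
  let W' : Submodule ℂ (EuclideanSpace ℂ (Fin d)) := W.comap e.toLinearMap
  let b := stdOrthonormalBasis ℂ W'
  have hin : ∀ x y : EuclideanSpace ℂ (Fin d), star (e x) ⬝ᵥ e y = inner ℂ x y := by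
    intro x y
    rw [EuclideanSpace.inner_eq_star_dotProduct, dotProduct_comm]
    rfl
  refine ⟨_, fun k => e (b k), fun k => (b k).2, fun k l => ?_, fun w hw => ?_⟩
  · rw [hin]
    have := orthonormal_iff_ite.1 b.orthonormal k l
    simpa using this
  · let w' : W' := ⟨e.symm w, by simpa [W'] using hw⟩
    have h := congrArg (fun z : W' => e z) (b.sum_repr' w')
    simp only [Submodule.coe_sum, Submodule.coe_smul, map_sum, map_smul] at h
    have hw' : e (w' : EuclideanSpace ℂ (Fin d)) = w := by simp [w']
    rw [hw'] at h
    conv_lhs => rw [← h]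
    refine Finset.sum_congr rfl fun k _ => ?_
    rw [← hw', hin]
    rfl

theorem card_le_of_star_dotProduct_eq_ite {d : ℕ} {α : Type*} [Fintype α] [DecidableEq α]
    (u : α → Fin d → ℂ) (hu : ∀ a b, star (u a) ⬝ᵥ u b = if a = b then 1 else 0) :
    Fintype.card α ≤ d := by
  have hv : Orthonormal ℂ fun a => WithLp.toLp 2 (u a) := by
    rw [orthonormal_iff_ite]
    intro a b
    rw [EuclideanSpace.inner_eq_star_dotProduct, dotProduct_comm]
    exact hu a b
  simpa using hv.linearIndependent.fintype_card_le_finrank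

theorem exists_unitary_mulVec_eq_single {d d₀ : ℕ} {α : Type*} [Fintype α] [DecidableEq α]
    (e : α ⊕ Fin d₀ ≃ Fin d) (u : α → Fin d → ℂ)
    (hu : ∀ a b, star (u a) ⬝ᵥ u b = if a = b then 1 else 0) :
    ∃ U : unitaryGroup (Fin d) ℂ, ∀ a,
      (U : Matrix (Fin d) (Fin d) ℂ) *ᵥ u a = Pi.single (e (Sum.inl a)) 1 := by
  let v : Fin d → EuclideanSpace ℂ (Fin d) :=
    fun i => WithLp.toLp 2 (Sum.elim u (fun _ => 0) (e.symm i))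
  have hin : ∀ x y : EuclideanSpace ℂ (Fin d), star x.ofLp ⬝ᵥ y.ofLp = inner ℂ x y := by
    intro x y
    rw [EuclideanSpace.inner_eq_star_dotProduct, dotProduct_comm]
  have hv : Orthonormal ℂ ((Set.range fun a => e (Sum.inl a)).domRestrict v) := by
    rw [orthonormal_iff_ite]
    rintro ⟨_, a, rfl⟩ ⟨_, b, rfl⟩
    rw [← hin]
    simp only [Set.domRestrict_apply, v, Equiv.symm_apply_apply, Sum.elim_inl, hu]
    exact if_congr ⟨fun h => h ▸ rfl,
      fun h => Sum.inl_injective (e.injective (congrArg Subtype.val h))⟩ rfl rfl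
  obtain ⟨b, hb⟩ := hv.exists_orthonormalBasis_extension_of_card_eq (by simp)
  have hbo := orthonormal_iff_ite.1 b.orthonormal
  let U : Matrix (Fin d) (Fin d) ℂ := of fun i j => star (b i j)
  have hU : U * star U = 1 := by
    ext i j
    have := hbo i j
    rw [← hin] at this
    simpa [U, mul_apply, dotProduct, one_apply] using this
  refine ⟨⟨U, mem_unitaryGroup_iff.2 hU⟩, fun a => ?_⟩
  have hba : u a = b (e (Sum.inl a)) := by
    rw [hb _ ⟨a, rfl⟩]
    simp [v]
  ext i
  have := hbo i (e (Sum.inl a))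
  rw [← hin] at this
  rw [hba]
  simpa [U, mulVec, dotProduct, Pi.single_apply] using this

/-- Take `c` an eigenvalue of `x a` on the range of `x`, with eigenvector `x u ≠ 0`. Then `u` lies
in the kernel of `x a x - c x` but not in that of `x`, so the kernel grows strictly. -/
theorem exists_sub_smul_rank_lt {d : ℕ} (x a : Matrix (Fin d) (Fin d) ℂ) (hx : x ≠ 0) :
    ∃ c : ℂ, (x * a * x - c • x).rank < x.rank := by
  let R := LinearMap.range x.mulVecLin
  let f : Module.End ℂ R :=
    LinearMap.restrict (x * a).mulVecLin (p := R) (q := R) (by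
      intro w _
      exact ⟨a *ᵥ w, by simp⟩)
  have : Nontrivial R := by
    rw [Submodule.nontrivial_iff_ne_bot, Ne, LinearMap.range_eq_bot]
    intro h
    apply hx
    ext i j
    simpa using congrFun (LinearMap.congr_fun h (Pi.single j 1)) i
  obtain ⟨c, hc⟩ := Module.End.exists_eigenvalue f
  obtain ⟨⟨_, u, rfl⟩, hw, hw0⟩ := hc.exists_hasEigenvector
  rw [Module.End.mem_eigenspace_iff] at hw
  have hw1 : (x * a) *ᵥ (x *ᵥ u) = c • (x *ᵥ u) := congrArg Subtype.val hw
  have hu : x *ᵥ u ≠ 0 := fun h => hw0 (Subtype.ext h)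
  refine ⟨c, ?_⟩
  have hlt : LinearMap.ker x.mulVecLin < LinearMap.ker (x * a * x - c • x).mulVecLin := by
    refine lt_of_le_of_ne (fun w hw => ?_) fun h => hu ?_
    · simp only [LinearMap.mem_ker, mulVecLin_apply] at hw ⊢
      rw [sub_mulVec, smul_mulVec, ← mulVec_mulVec, hw]
      simp
    · have : u ∈ LinearMap.ker (x * a * x - c • x).mulVecLin := by
        simp only [LinearMap.mem_ker, mulVecLin_apply]
        rw [sub_mulVec, smul_mulVec, ← mulVec_mulVec, hw1, sub_self]
      rw [← h] at this
      exact this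
  have h1 := Submodule.finrank_lt_finrank_of_lt hlt
  have h2 := LinearMap.finrank_range_add_finrank_ker x.mulVecLin
  have h3 := LinearMap.finrank_range_add_finrank_ker (x * a * x - c • x).mulVecLin
  unfold rank
  omega

end Matrix

/-! ### Minimal projections and their left ideals. -/

namespace NonUnitalStarSubalgebra
open Matrix
open scoped ComplexOrder
variable {d : ℕ}

/-- For nonzero `x ∈ 𝒜` of least rank, `exists_sub_smul_rank_lt` forces `x a x ∈ ℂx`. The
self-adjoint `h = x†x` inherits this property, and a scalar multiple of `h` is the projection. -/
theorem exists_minimal_projection (𝒜 : NonUnitalStarSubalgebra ℂ (Matrix (Fin d) (Fin d) ℂ))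
    (h𝒜 : ∃ a ∈ 𝒜, a ≠ 0) :
    ∃ p ∈ 𝒜, p ≠ 0 ∧ pᴴ = p ∧ p * p = p ∧ ∀ a ∈ 𝒜, ∃ c : ℂ, p * a * p = c • p := by
  obtain ⟨x, ⟨hx, hx0⟩, hmin⟩ := exists_minimalFor_of_wellFoundedLT
    (fun a : Matrix (Fin d) (Fin d) ℂ => a ∈ 𝒜 ∧ a ≠ 0) Matrix.rank h𝒜
  have hxs : xᴴ ∈ 𝒜 := star_mem hx
  have hxa : ∀ a ∈ 𝒜, ∃ c : ℂ, x * a * x = c • x := by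
    intro a ha
    obtain ⟨c, hc⟩ := exists_sub_smul_rank_lt x a hx0
    refine ⟨c, ?_⟩
    by_contra hne
    have := hmin (j := x * a * x - c • x)
      ⟨sub_mem (mul_mem (mul_mem hx ha) hx) (𝒜.smul_mem' c hx), sub_ne_zero.2 hne⟩ hc.le
    omega
  set h := xᴴ * x with hh
  have hh𝒜 : h ∈ 𝒜 := mul_mem hxs hx
  have hhs : hᴴ = h := by simp [hh]
  have hsq : ∀ y : Matrix (Fin d) (Fin d) ℂ, yᴴ = y → y ≠ 0 → y * y ≠ 0 := by
    intro y hy hy0 h0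
    apply hy0
    rw [← conjTranspose_mul_self_eq_zero, hy, h0]
  have hh0 : h ≠ 0 := fun h0 => hx0 (conjTranspose_mul_self_eq_zero.1 h0)
  have hha : ∀ a ∈ 𝒜, ∃ c : ℂ, h * a * h = c • h := by
    intro a ha
    obtain ⟨c, hc⟩ := hxa (a * xᴴ) (mul_mem ha hxs)
    refine ⟨c, ?_⟩
    rw [hh, ← Matrix.mul_smul, ← hc]
    simp only [Matrix.mul_assoc]
  have hhh0 := hsq h hhs hh0
  have h40 := hsq (h * h) (by simp [hhs]) hhh0
  obtain ⟨l, hl⟩ := hha h hh𝒜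
  obtain ⟨μ, hμ⟩ := hha (h * h) (mul_mem hh𝒜 hh𝒜)
  have hl0 : l ≠ 0 := by
    rintro rfl
    apply h40
    rw [← Matrix.mul_assoc, hl]
    simp
  -- The algebra need not have a unit, so `a = 1` is unavailable. Instead `h³ = l h` and `h⁴ = μ h`
  -- give `l h² = μ h`, and `l ≠ 0` because `h⁴ ≠ 0`.
  obtain ⟨ν, hν⟩ : ∃ ν : ℂ, h * h = ν • h := by
    refine ⟨l⁻¹ * μ, ?_⟩
    rw [mul_smul, ← hμ, ← Matrix.mul_assoc h h h, hl, smul_mul_assoc, smul_smul,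
      inv_mul_cancel₀ hl0, one_smul]
  have hν0 : ν ≠ 0 := by
    rintro rfl
    exact hhh0 (by simp [hν])
  have hνs : star ν = ν := by
    have h1 := congrArg conjTranspose hν
    rw [conjTranspose_mul, hhs, conjTranspose_smul, hhs, hν] at h1
    exact (smul_left_injective ℂ hh0 h1).symm
  refine ⟨ν⁻¹ • h, 𝒜.smul_mem' _ hh𝒜, smul_ne_zero (inv_ne_zero hν0) hh0, ?_, ?_, fun a ha => ?_⟩
  · rw [conjTranspose_smul, hhs, star_inv₀, hνs]
  · rw [smul_mul_smul_comm, hν, smul_smul]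
    congr 1
    field_simp
  · obtain ⟨c, hc⟩ := hha a ha
    refine ⟨ν⁻¹ * c, ?_⟩
    rw [smul_mul_assoc, smul_mul_smul_comm, hc, smul_smul, smul_smul]
    congr 1
    ring

/-- Orthonormal columns for the left ideal generated by a minimal projection. -/
theorem exists_orthonormal_columns (𝒜 : NonUnitalStarSubalgebra ℂ (Matrix (Fin d) (Fin d) ℂ))
    {p : Matrix (Fin d) (Fin d) ℂ} (hp : p ∈ 𝒜) (hp0 : p ≠ 0) (hps : pᴴ = p) (hpp : p * p = p)
    (hmin : ∀ a ∈ 𝒜, ∃ c : ℂ, p * a * p = c • p) :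
    ∃ (n : ℕ) (x : Fin n → Matrix (Fin d) (Fin d) ℂ), (∀ k, x k ∈ 𝒜) ∧ (∀ k, x k * p = x k) ∧
      (∀ k l, (x k)ᴴ * x l = if k = l then p else 0) ∧
      ∀ a ∈ 𝒜, (∑ k, x k * (x k)ᴴ) * (a * p) = a * p := by
  obtain ⟨v, hvv, hpv⟩ : ∃ v, star v ⬝ᵥ v = 1 ∧ p *ᵥ v = v := by
    obtain ⟨n, b, hbW, hb, hW⟩ := exists_orthonormal_expansion (LinearMap.range p.mulVecLin)
    rcases n with _ | n
    · exfalso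
      apply hp0
      ext i j
      simpa using congrFun (hW (p *ᵥ Pi.single j 1) ⟨_, rfl⟩) i
    · obtain ⟨w, hw⟩ := hbW 0
      refine ⟨b 0, by simpa using hb 0 0, ?_⟩
      rw [← hw, mulVecLin_apply, mulVec_mulVec, hpp]
  let L : Submodule ℂ (Matrix (Fin d) (Fin d) ℂ) :=
    { carrier := {y | y ∈ 𝒜 ∧ y * p = y}
      add_mem' := fun ha hb => ⟨add_mem ha.1 hb.1, by rw [add_mul, ha.2, hb.2]⟩
      zero_mem' := ⟨zero_mem _, by simp⟩
      smul_mem' := fun c y hy => ⟨𝒜.smul_mem' c hy.1, by rw [smul_mul_assoc, hy.2]⟩ }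
  -- Evaluation at the unit vector `v` in the range of `p` identifies the scalar in `y†z ∈ ℂp` with
  -- an inner product in `ℂ^d`; in particular it is injective on `L`.
  have key : ∀ y ∈ L, ∀ z ∈ L, yᴴ * z = (star (y *ᵥ v) ⬝ᵥ (z *ᵥ v)) • p := by
    rintro y ⟨hy, hyp⟩ z ⟨hz, hzp⟩
    obtain ⟨c, hc⟩ := hmin (yᴴ * z) (mul_mem (star_mem hy) hz)
    have h1 : yᴴ * z = c • p := by
      rw [← hc]
      conv_lhs => rw [← hyp, ← hzp]
      rw [conjTranspose_mul, hps]
      simp only [Matrix.mul_assoc]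
    have h2 : star (y *ᵥ v) ⬝ᵥ (z *ᵥ v) = c := by
      rw [star_mulVec, ← dotProduct_mulVec, mulVec_mulVec, h1, smul_mulVec, hpv, dotProduct_smul,
        hvv, smul_eq_mul, mul_one]
    rw [h1, h2]
  let T : Matrix (Fin d) (Fin d) ℂ →ₗ[ℂ] (Fin d → ℂ) :=
    { toFun := fun y => y *ᵥ v
      map_add' := fun a b => add_mulVec a b v
      map_smul' := fun c a => smul_mulVec c a v }
  obtain ⟨n, b, hbW, hb, hW⟩ := exists_orthonormal_expansion (L.map T)
  choose x hxL hxb using hbW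
  replace hxb : ∀ k, x k *ᵥ v = b k := hxb
  refine ⟨n, x, fun k => (hxL k).1, fun k => (hxL k).2, fun k l => ?_, fun a ha => ?_⟩
  · rw [key _ (hxL k) _ (hxL l), hxb, hxb, hb]
    split_ifs <;> simp
  have hy : a * p ∈ L := ⟨mul_mem ha hp, by rw [Matrix.mul_assoc, hpp]⟩
  generalize a * p = y at hy
  have hsum : ∑ k, (star (b k) ⬝ᵥ (y *ᵥ v)) • x k = y := by
    have hz : y - ∑ k, (star (b k) ⬝ᵥ (y *ᵥ v)) • x k ∈ L :=
      sub_mem hy (sum_mem fun k _ => L.smul_mem _ (hxL k))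
    have hzv : (y - ∑ k, (star (b k) ⬝ᵥ (y *ᵥ v)) • x k) *ᵥ v = 0 := by
      rw [sub_mulVec, sum_mulVec]
      simp only [smul_mulVec, hxb]
      exact sub_eq_zero.2 (hW _ ⟨y, hy, rfl⟩)
    have h0 := key _ hz _ hz
    rw [hzv, dotProduct_zero, zero_smul, conjTranspose_mul_self_eq_zero] at h0
    exact (sub_eq_zero.1 h0).symm
  conv_rhs => rw [← hsum]
  rw [Matrix.sum_mul]
  refine Finset.sum_congr rfl fun k _ => ?_
  rw [Matrix.mul_assoc, key _ (hxL k) _ hy, hxb, Matrix.mul_smul, (hxL k).2]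

end NonUnitalStarSubalgebra

/-- A system of partial isometries `col i k`, with common initial projection `proj i`, whose
products `col i k * (col i l)ᴴ` are matrix units spanning `𝒜`. -/
structure MatrixUnits {d : ℕ} (𝒜 : NonUnitalStarSubalgebra ℂ (Matrix (Fin d) (Fin d) ℂ))
    (ι : Type) [Fintype ι] where
  size : ι → ℕ
  proj : ι → Matrix (Fin d) (Fin d) ℂ
  col : (i : ι) → Fin (size i) → Matrix (Fin d) (Fin d) ℂ
  size_pos : ∀ i, 0 < size i
  proj_ne_zero : ∀ i, proj i ≠ 0
  proj_conjTranspose : ∀ i, (proj i)ᴴ = proj i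
  proj_mul_self : ∀ i, proj i * proj i = proj i
  col_mem : ∀ i k, col i k ∈ 𝒜
  col_mul_proj : ∀ i k, col i k * proj i = col i k
  conjTranspose_col_mul_col : ∀ i k l, (col i k)ᴴ * col i l = if k = l then proj i else 0
  conjTranspose_col_mul_col_of_ne : ∀ i j, i ≠ j → ∀ k l, (col i k)ᴴ * col j l = 0
  exists_eq_sum : ∀ a ∈ 𝒜, ∃ X : (i : ι) → Matrix (Fin (size i)) (Fin (size i)) ℂ,
    a = ∑ i, ∑ k, ∑ l, X i k l • (col i k * (col i l)ᴴ)

namespace MatrixUnits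
open Matrix
variable {d : ℕ}

/-- Relabelling of the index type. -/
def congr {𝒜 : NonUnitalStarSubalgebra ℂ (Matrix (Fin d) (Fin d) ℂ)} {ι κ : Type} [Fintype ι]
    [Fintype κ] (e : κ ≃ ι) (S : MatrixUnits 𝒜 ι) : MatrixUnits 𝒜 κ where
  size i := S.size (e i)
  proj i := S.proj (e i)
  col i := S.col (e i)
  size_pos i := S.size_pos (e i)
  proj_ne_zero i := S.proj_ne_zero (e i)
  proj_conjTranspose i := S.proj_conjTranspose (e i)
  proj_mul_self i := S.proj_mul_self (e i)
  col_mem i := S.col_mem (e i)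
  col_mul_proj i := S.col_mul_proj (e i)
  conjTranspose_col_mul_col i := S.conjTranspose_col_mul_col (e i)
  conjTranspose_col_mul_col_of_ne i j h :=
    S.conjTranspose_col_mul_col_of_ne (e i) (e j) (e.injective.ne h)
  exists_eq_sum a ha := by
    obtain ⟨X, hX⟩ := S.exists_eq_sum a ha
    refine ⟨fun i => X (e i), ?_⟩
    rw [hX]
    exact (e.sum_comp fun i => ∑ k, ∑ l, X i k l • (S.col i k * (S.col i l)ᴴ)).symm

end MatrixUnits

/-! ### Matrix units, by splitting off central projections. -/

namespace NonUnitalStarSubalgebra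
open Matrix
variable {d : ℕ}

/-- The elements of `𝒜` annihilated by `q`, where `q` is self-adjoint and commutes with `𝒜`. -/
def annihilator (𝒜 : NonUnitalStarSubalgebra ℂ (Matrix (Fin d) (Fin d) ℂ))
    (q : Matrix (Fin d) (Fin d) ℂ) (hq : qᴴ = q) (hcomm : ∀ a ∈ 𝒜, q * a = a * q) :
    NonUnitalStarSubalgebra ℂ (Matrix (Fin d) (Fin d) ℂ) where
  carrier := {a | a ∈ 𝒜 ∧ q * a = 0}
  add_mem' ha hb := ⟨add_mem ha.1 hb.1, by rw [Matrix.mul_add, ha.2, hb.2, add_zero]⟩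
  zero_mem' := ⟨zero_mem _, Matrix.mul_zero _⟩
  mul_mem' ha hb := ⟨mul_mem ha.1 hb.1, by rw [← Matrix.mul_assoc, ha.2, Matrix.zero_mul]⟩
  smul_mem' c a ha := ⟨𝒜.smul_mem' c ha.1, by rw [Matrix.mul_smul, ha.2, smul_zero]⟩
  star_mem' {a} ha := ⟨star_mem ha.1, by
    rw [hcomm _ (star_mem ha.1), star_eq_conjTranspose, ← hq, ← conjTranspose_mul, ha.2,
      conjTranspose_zero]⟩

/-- Induction on the dimension of `𝒜`: one block comes from a minimal projection, the others from
the annihilator of its central projection `q`, which is smaller because it misses `q`. -/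
theorem exists_matrixUnits (𝒜 : NonUnitalStarSubalgebra ℂ (Matrix (Fin d) (Fin d) ℂ)) :
    ∃ (ι : Type) (_ : Fintype ι), Nonempty (MatrixUnits 𝒜 ι) := by
  induction hr : Module.finrank ℂ 𝒜.toSubmodule using Nat.strong_induction_on generalizing 𝒜 with
  | _ r ih =>
  by_cases h𝒜 : ∃ a ∈ 𝒜, a ≠ 0
  swap
  · push Not at h𝒜
    exact ⟨Empty, inferInstance, ⟨{
      size := Empty.elim
      proj := Empty.elim
      col := fun i => i.elim
      size_pos := fun i => i.elim
      proj_ne_zero := fun i => i.elim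
      proj_conjTranspose := fun i => i.elim
      proj_mul_self := fun i => i.elim
      col_mem := fun i => i.elim
      col_mul_proj := fun i => i.elim
      conjTranspose_col_mul_col := fun i => i.elim
      conjTranspose_col_mul_col_of_ne := fun i => i.elim
      exists_eq_sum := fun a ha => ⟨fun i => i.elim, by simpa using h𝒜 a ha⟩ }⟩⟩
  obtain ⟨p, hp, hp0, hps, hpp, hmin⟩ := exists_minimal_projection 𝒜 h𝒜
  obtain ⟨n, x, hx, hxp, hxx, hxa⟩ := exists_orthonormal_columns 𝒜 hp hp0 hps hpp hmin
  set q := ∑ k, x k * (x k)ᴴ with hq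
  have hqs : qᴴ = q := by simp [hq, conjTranspose_sum]
  have hq𝒜 : q ∈ 𝒜 := sum_mem fun k _ => mul_mem (hx k) (star_mem (hx k))
  have hqax : ∀ a ∈ 𝒜, ∀ k, q * (a * x k) = a * x k := by
    intro a ha k
    rw [← hxp k, ← Matrix.mul_assoc a]
    exact hxa _ (mul_mem ha (hx k))
  have hqx : ∀ k, q * x k = x k := by
    intro k
    rw [← hxp k]
    exact hxa _ (hx k)
  have hqaq : ∀ a ∈ 𝒜, q * (a * q) = a * q := by
    intro a ha
    have : a * q = ∑ k, a * x k * (x k)ᴴ := by simp only [hq, Matrix.mul_sum, Matrix.mul_assoc]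
    rw [this, Matrix.mul_sum]
    exact Finset.sum_congr rfl fun k _ => by rw [← Matrix.mul_assoc q, hqax a ha]
  -- The range of `q` is invariant under `𝒜`. As `𝒜` is closed under adjoints, `q a q = a q` for
  -- `a†` also gives `q a q = q a`.
  have hcomm : ∀ a ∈ 𝒜, q * a = a * q := by
    intro a ha
    rw [← hqaq a ha]
    have h1 := congrArg conjTranspose (hqaq aᴴ (star_mem ha))
    simp only [conjTranspose_mul, conjTranspose_conjTranspose, hqs] at h1
    rw [← h1, Matrix.mul_assoc]
  have hp_eq : q * p = p := by
    have := hxa p hp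
    rwa [hpp] at this
  have hq0 : q ≠ 0 := by
    intro h0
    rw [h0, Matrix.zero_mul] at hp_eq
    exact hp0 hp_eq.symm
  have hn : 0 < n := by
    rcases n.eq_zero_or_pos with rfl | h
    · exact absurd (by simp [hq]) hq0
    · exact h
  have hqq : q * q = q := by
    calc q * q = ∑ k, q * (x k * (x k)ᴴ) := Matrix.mul_sum ..
      _ = q := Finset.sum_congr rfl fun k _ => by rw [← Matrix.mul_assoc, hqx]
  let ℬ := 𝒜.annihilator q hqs hcomm
  have hlt : Module.finrank ℂ ℬ.toSubmodule < r := by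
    rw [← hr]
    refine Submodule.finrank_lt_finrank_of_lt (lt_of_le_of_ne (fun a ha => ha.1) fun h => hq0 ?_)
    have h1 : q ∈ ℬ.toSubmodule := by
      rw [h]
      exact hq𝒜
    rw [← hqq]
    exact h1.2
  obtain ⟨ι, _, ⟨S⟩⟩ := ih _ hlt ℬ rfl
  have hxS : ∀ i k l, (x k)ᴴ * S.col i l = 0 := by
    intro i k l
    rw [← hqx k, conjTranspose_mul, hqs, Matrix.mul_assoc, (S.col_mem i l).2, Matrix.mul_zero]
  refine ⟨Option ι, inferInstance, ⟨{
    size := fun i => i.elim n S.size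
    proj := fun i => i.elim p S.proj
    col := fun i => match i with
      | none => x
      | some i => S.col i
    size_pos := ?_
    proj_ne_zero := ?_
    proj_conjTranspose := ?_
    proj_mul_self := ?_
    col_mem := ?_
    col_mul_proj := ?_
    conjTranspose_col_mul_col := ?_
    conjTranspose_col_mul_col_of_ne := ?_
    exists_eq_sum := ?_ }⟩⟩
  · rintro (_ | i)
    exacts [hn, S.size_pos i]
  · rintro (_ | i)
    exacts [hp0, S.proj_ne_zero i]
  · rintro (_ | i)
    exacts [hps, S.proj_conjTranspose i]
  · rintro (_ | i)
    exacts [hpp, S.proj_mul_self i]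
  · rintro (_ | i) k
    exacts [hx k, (S.col_mem i k).1]
  · rintro (_ | i) k
    exacts [hxp k, S.col_mul_proj i k]
  · rintro (_ | i) k l
    exacts [hxx k l, S.conjTranspose_col_mul_col i k l]
  · rintro (_ | i) (_ | j) hij k l
    · exact absurd rfl hij
    · exact hxS j k l
    · have h1 := congrArg conjTranspose (hxS i l k)
      rwa [conjTranspose_mul, conjTranspose_conjTranspose, conjTranspose_zero] at h1
    · exact S.conjTranspose_col_mul_col_of_ne i j (fun h => hij (congrArg some h)) k l
  · intro a ha
    -- Split `a = q a + (a - q a)`: the second part is expanded by the induction hypothesis, the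
    -- first as `q a q` with `x_k† a x_l = C k l • p`.
    have hb : a - q * a ∈ ℬ := ⟨sub_mem ha (mul_mem hq𝒜 ha), by
      rw [Matrix.mul_sub, ← Matrix.mul_assoc, hqq, sub_self]⟩
    obtain ⟨Y, hY⟩ := S.exists_eq_sum _ hb
    have hc : ∀ k l, ∃ c : ℂ, (x k)ᴴ * a * x l = c • p := by
      intro k l
      obtain ⟨c, hc⟩ := hmin ((x k)ᴴ * a * x l) (mul_mem (mul_mem (star_mem (hx k)) ha) (hx l))
      refine ⟨c, ?_⟩
      rw [← hc]
      conv_lhs => rw [← hxp k, ← hxp l]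
      rw [conjTranspose_mul, hps]
      simp only [Matrix.mul_assoc]
    choose C hC using hc
    have hqa : q * a = ∑ k, ∑ l, C k l • (x k * (x l)ᴴ) := by
      rw [← hqq, Matrix.mul_assoc, hcomm a ha]
      conv_lhs => rw [hq, Matrix.sum_mul]
      refine Finset.sum_congr rfl fun k _ => ?_
      rw [Matrix.mul_sum, Matrix.mul_sum]
      refine Finset.sum_congr rfl fun l _ => ?_
      have : x k * (x k)ᴴ * (a * (x l * (x l)ᴴ)) = x k * ((x k)ᴴ * a * x l) * (x l)ᴴ := by
        simp only [Matrix.mul_assoc]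
      rw [this, hC, Matrix.mul_smul, smul_mul_assoc, hxp]
    refine ⟨fun i => match i with
      | none => of C
      | some i => Y i, ?_⟩
    rw [Fintype.sum_option]
    calc a = q * a + (a - q * a) := by abel
      _ = _ := by rw [hqa] at hY ⊢; rw [hY]; rfl

end NonUnitalStarSubalgebra

/-! ### Block diagonal matrices and the center. -/

section BlockSum
open Matrix
variable {d N d₀ : ℕ} (m n : Fin N → ℕ) (hd : ∑ i, n i * m i + d₀ = d)

theorem blockSum_apply_same (X : (i : Fin N) → Matrix (Fin (n i)) (Fin (n i)) ℂ) (i : Fin N)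
    (j j' : Fin (m i)) (k l : Fin (n i)) :
    blockSum m n hd X (blockIndexEquiv m n hd (Sum.inl ⟨i, j, k⟩))
      (blockIndexEquiv m n hd (Sum.inl ⟨i, j', l⟩)) = if j = j' then X i k l else 0 := by
  simp [blockSum, blockDiagonal'_apply_eq, kroneckerMap_apply, one_apply]

/-- Written in rank-one terms, the block form can be compared directly with the conjugated matrix
units. -/
theorem blockSum_eq_sum_vecMulVec (X : (i : Fin N) → Matrix (Fin (n i)) (Fin (n i)) ℂ) :
    blockSum m n hd X = ∑ i, ∑ k, ∑ l, X i k l • ∑ j : Fin (m i),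
      vecMulVec (Pi.single (blockIndexEquiv m n hd (Sum.inl ⟨i, j, k⟩)) 1)
        (Pi.single (blockIndexEquiv m n hd (Sum.inl ⟨i, j, l⟩)) 1) := by
  ext a b
  obtain ⟨s, rfl⟩ := (blockIndexEquiv m n hd).surjective a
  obtain ⟨t, rfl⟩ := (blockIndexEquiv m n hd).surjective b
  simp only [Matrix.sum_apply, Matrix.smul_apply, vecMulVec_apply, Pi.single_apply, EmbeddingLike.apply_eq_iff_eq,
    smul_eq_mul]
  rcases s with ⟨i, j, k⟩ | s
  swap
  · rcases t with t | t <;> simp [blockSum]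
  rcases t with ⟨i', j', l⟩ | t
  swap
  · simp [blockSum]
  by_cases hi : i = i'
  · subst hi
    rw [blockSum_apply_same, Fintype.sum_eq_single i, Fintype.sum_eq_single k,
      Fintype.sum_eq_single l, Fintype.sum_eq_single j]
    · simp [eq_comm]
    · intro x hx
      simp [hx.symm]
    · intro x hx
      simp [hx.symm]
    · intro x hx
      simp [hx.symm]
    · intro x hx
      simp [hx.symm]
  · rw [Fintype.sum_eq_single i]
    · simp [blockSum, blockDiagonal'_apply_ne _ _ _ hi, Ne.symm hi]
    · intro x hx
      simp [hx.symm]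

theorem blockSum_mul (X Y : (i : Fin N) → Matrix (Fin (n i)) (Fin (n i)) ℂ) :
    blockSum m n hd X * blockSum m n hd Y = blockSum m n hd (fun i => X i * Y i) := by
  unfold blockSum
  rw [reindex_apply, reindex_apply, reindex_apply, submatrix_mul_equiv, fromBlocks_multiply]
  simp only [Matrix.mul_zero, Matrix.zero_mul, add_zero, ← blockDiagonal'_mul, ← mul_kronecker_mul,
    Matrix.mul_one]

/-- A block of multiplicity 0 occupies no coordinates, so its `X i` is undetermined. This is what
lets the description of the center cover zero multiplicities. -/
theorem blockSum_congr {X Y : (i : Fin N) → Matrix (Fin (n i)) (Fin (n i)) ℂ}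
    (h : ∀ i, 0 < m i → X i = Y i) : blockSum m n hd X = blockSum m n hd Y := by
  simp only [blockSum_eq_sum_vecMulVec]
  refine Finset.sum_congr rfl fun i _ => ?_
  rcases (m i).eq_zero_or_pos with hi | hi
  · have : IsEmpty (Fin (m i)) := by
      rw [hi]
      infer_instance
    simp
  · rw [h i hi]

theorem algebraCenter_eq_of_isBlockDecomposition
    (𝒜 : NonUnitalStarSubalgebra ℂ (Matrix (Fin d) (Fin d) ℂ)) (U : unitaryGroup (Fin d) ℂ)
    (h : IsBlockDecomposition 𝒜 U m n hd) :
    algebraCenter 𝒜 = {A | ∃ α : Fin N → ℂ, A = (U : Matrix (Fin d) (Fin d) ℂ)ᴴ *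
      blockSum m n hd (fun i => α i • (1 : Matrix (Fin (n i)) (Fin (n i)) ℂ)) *
      (U : Matrix (Fin d) (Fin d) ℂ)} := by
  obtain ⟨U, hU⟩ := U
  have hUU : Uᴴ * U = 1 := mem_unitaryGroup_iff'.1 hU
  unfold IsBlockDecomposition at h
  simp only at h ⊢
  have hconj : ∀ A, Uᴴ * (U * A * Uᴴ) * U = A := by
    intro A
    rw [← Matrix.mul_assoc, ← Matrix.mul_assoc, hUU, Matrix.one_mul, Matrix.mul_assoc, hUU,
      Matrix.mul_one]
  have hmul : ∀ A B, (U * A * Uᴴ) * (U * B * Uᴴ) = U * (A * B) * Uᴴ := by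
    intro A B
    calc _ = U * A * (Uᴴ * U) * B * Uᴴ := by simp only [Matrix.mul_assoc]
      _ = _ := by rw [hUU, Matrix.mul_one, Matrix.mul_assoc U A B]
  ext A
  constructor
  · rintro ⟨hA, hAB⟩
    obtain ⟨X, hX⟩ : U * A * Uᴴ ∈ Set.range (blockSum m n hd) := h ▸ ⟨A, hA, rfl⟩
    have hXY : ∀ Y : (i : Fin N) → Matrix (Fin (n i)) (Fin (n i)) ℂ,
        blockSum m n hd (fun i => X i * Y i) =
          blockSum m n hd fun i => Y i * X i := by
      intro Y
      obtain ⟨B, hB, hBY⟩ := h.symm ▸ Set.mem_range_self (f := blockSum m n hd) Y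
      simp only at hBY
      rw [← blockSum_mul, ← blockSum_mul, ← hBY, hX, hmul, hmul, hAB B hB]
    have hs : ∀ i, ∃ c : ℂ, 0 < m i → X i = c • 1 := by
      intro i
      by_cases hi : 0 < m i
      · have hcomm : ∀ Y : Matrix (Fin (n i)) (Fin (n i)) ℂ, X i * Y = Y * X i := by
          intro Y
          ext k l
          -- Test against the element equal to `Y` in block `i` and 0 elsewhere, and read off the
          -- first copy of block `i`, which exists because `0 < m i`.
          have h1 := congrFun (congrFun (hXY (Function.update 0 i Y))
            (blockIndexEquiv m n hd (Sum.inl ⟨i, ⟨0, hi⟩, k⟩)))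
            (blockIndexEquiv m n hd (Sum.inl ⟨i, ⟨0, hi⟩, l⟩))
          simpa only [blockSum_apply_same, Function.update_self, if_true] using h1
        obtain ⟨c, hc⟩ := mem_range_scalar_of_commute_single (M := X i)
          fun k l _ => (hcomm _).symm
        exact ⟨c, fun _ => by rw [← hc, smul_one_eq_diagonal]; rfl⟩
      · exact ⟨0, fun h => absurd h hi⟩
    choose α hα using hs
    exact ⟨α, by rw [← blockSum_congr m n hd hα, hX, hconj]⟩
  · rintro ⟨α, rfl⟩
    obtain ⟨A, hA, hAX⟩ := h.symm ▸ Set.mem_range_self (f := blockSum m n hd) fun i => α i • 1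
    simp only at hAX
    rw [← hAX, hconj]
    refine ⟨hA, fun B hB => ?_⟩
    obtain ⟨Y, hY⟩ : U * B * Uᴴ ∈ Set.range (blockSum m n hd) := h ▸ ⟨B, hB, rfl⟩
    rw [← hconj (A * B), ← hconj (B * A), ← hmul, ← hmul, hAX, ← hY, blockSum_mul, blockSum_mul]
    simp

end BlockSum

/-! ### The unitary that brings the algebra to block form. -/

section Decomposition
open Matrix
variable {d : ℕ}

theorem Matrix.exists_eq_sum_vecMulVec {p : Matrix (Fin d) (Fin d) ℂ} (hp0 : p ≠ 0) (hps : pᴴ = p)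
    (hpp : p * p = p) : ∃ (m : ℕ) (v : Fin m → Fin d → ℂ), 0 < m ∧ (∀ j, p *ᵥ v j = v j) ∧
      (∀ j j', star (v j) ⬝ᵥ v j' = if j = j' then 1 else 0) ∧
      p = ∑ j, vecMulVec (v j) (star (v j)) := by
  obtain ⟨m, v, hvW, hv, hW⟩ := exists_orthonormal_expansion (LinearMap.range p.mulVecLin)
  have hpv : ∀ j, p *ᵥ v j = v j := by
    intro j
    obtain ⟨w, hw⟩ := hvW j
    rw [← hw, mulVecLin_apply, mulVec_mulVec, hpp]
  have hsum : p = ∑ j, vecMulVec (v j) (star (v j)) := by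
    refine ext_of_mulVec_single fun i => ?_
    rw [hW (p *ᵥ Pi.single i 1) ⟨_, rfl⟩, sum_mulVec]
    refine Finset.sum_congr rfl fun j _ => ?_
    have hstar := star_mulVec p (v j)
    rw [hpv, hps] at hstar
    rw [vecMulVec_mulVec, dotProduct_mulVec, ← hstar]
    simp
  refine ⟨m, v, ?_, hpv, hv, hsum⟩
  rcases m.eq_zero_or_pos with rfl | h
  · exact absurd (by simpa using hsum) hp0
  · exact h

theorem exists_isBlockDecomposition (𝒜 : NonUnitalStarSubalgebra ℂ (Matrix (Fin d) (Fin d) ℂ)) :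
    ∃ (N d₀ : ℕ) (m n : Fin N → ℕ) (hd : ∑ i, n i * m i + d₀ = d) (U : unitaryGroup (Fin d) ℂ),
      (∀ i, 0 < m i ∧ 0 < n i) ∧ IsBlockDecomposition 𝒜 U m n hd := by
  obtain ⟨ι, _, ⟨S'⟩⟩ := 𝒜.exists_matrixUnits
  let S := S'.congr (Fintype.equivFin ι).symm
  let n := S.size
  choose m v hm hpv hv hsum using fun i =>
    exists_eq_sum_vecMulVec (S.proj_ne_zero i) (S.proj_conjTranspose i) (S.proj_mul_self i)
  -- Each `col i k` is isometric on the range of `proj i`, and columns with different labels have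
  -- orthogonal ranges, so this family is orthonormal.
  let u : (Σ i, Fin (m i) × Fin (n i)) → Fin d → ℂ := fun a => S.col a.1 a.2.2 *ᵥ v a.1 a.2.1
  have hu : ∀ a b, star (u a) ⬝ᵥ u b = if a = b then 1 else 0 := by
    rintro ⟨i, j, k⟩ ⟨i', j', l⟩
    simp only [u]
    rw [star_mulVec, ← dotProduct_mulVec, mulVec_mulVec]
    by_cases hi : i = i'
    · subst hi
      rw [S.conjTranspose_col_mul_col]
      by_cases hkl : k = l
      · simp [hkl, hpv, hv]
      · simp [hkl]
    · rw [S.conjTranspose_col_mul_col_of_ne _ _ hi]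
      simp [hi]
  have hcard : ∑ i, n i * m i ≤ d := by
    simpa [mul_comm] using card_le_of_star_dotProduct_eq_ite u hu
  -- The zero block has the dimension left over by the orthonormal family.
  obtain ⟨d₀, hd⟩ := Nat.exists_eq_add_of_le hcard
  refine ⟨_, d₀, m, n, hd.symm, ?_⟩
  obtain ⟨⟨U, hU⟩, hUu⟩ := exists_unitary_mulVec_eq_single (blockIndexEquiv m n hd.symm) u hu
  refine ⟨⟨U, hU⟩, fun i => ⟨hm i, S.size_pos i⟩, ?_⟩
  simp only at hUu
  -- Insert `proj i = ∑ v_j v_j†` between the two columns: the product becomes `∑ u_(i,j,k)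
  -- u_(i,j,l)†` over `j`, and `U` sends each `u` to a standard basis vector.
  have hcol : ∀ i k l, U * (S.col i k * (S.col i l)ᴴ) * Uᴴ = ∑ j : Fin (m i),
      vecMulVec (Pi.single (blockIndexEquiv m n hd.symm (Sum.inl ⟨i, j, k⟩)) 1)
        (Pi.single (blockIndexEquiv m n hd.symm (Sum.inl ⟨i, j, l⟩)) 1) := by
    intro i k l
    rw [← S.col_mul_proj i k, hsum i, Matrix.mul_sum, Matrix.sum_mul, Matrix.mul_sum,
      Matrix.sum_mul]
    refine Finset.sum_congr rfl fun j _ => ?_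
    rw [mul_vecMulVec, vecMulVec_mul, mul_vecMulVec, vecMulVec_mul, ← star_mulVec, ← star_mulVec]
    rw [show S.col i k *ᵥ v i j = u ⟨i, j, k⟩ from rfl,
      show S.col i l *ᵥ v i j = u ⟨i, j, l⟩ from rfl, hUu, hUu, ← Pi.single_star, star_one]
  have hblock : ∀ X : (i : _) → Matrix (Fin (n i)) (Fin (n i)) ℂ, blockSum m n hd.symm X =
      U * (∑ i, ∑ k, ∑ l, X i k l • (S.col i k * (S.col i l)ᴴ)) * Uᴴ := by
    intro X
    rw [blockSum_eq_sum_vecMulVec]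
    simp only [← hcol, Matrix.mul_sum, Matrix.sum_mul, Matrix.mul_smul, Matrix.smul_mul]
  ext M
  constructor
  · rintro ⟨A, hA, rfl⟩
    obtain ⟨X, hX⟩ := S.exists_eq_sum A hA
    exact ⟨X, by rw [hblock, ← hX]⟩
  · rintro ⟨X, rfl⟩
    refine ⟨_, ?_, (hblock X).symm⟩
    exact sum_mem fun i _ => sum_mem fun k _ => sum_mem fun l _ =>
      𝒜.smul_mem' _ (mul_mem (S.col_mem i k) (star_mem (S.col_mem i l)))

end Decomposition

theorem mainTheorem1 (d : ℕ) (𝒜 : NonUnitalStarSubalgebra ℂ (Matrix (Fin d) (Fin d) ℂ)) :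
    (∃ (N d₀ : ℕ) (m n : Fin N → ℕ) (hd : ∑ i, n i * m i + d₀ = d)
        (U : Matrix.unitaryGroup (Fin d) ℂ),
      (∀ i, 0 < m i ∧ 0 < n i) ∧ IsBlockDecomposition 𝒜 U m n hd) ∧
    (∀ (N d₀ : ℕ) (m n : Fin N → ℕ) (hd : ∑ i, n i * m i + d₀ = d)
        (U : Matrix.unitaryGroup (Fin d) ℂ),
      IsBlockDecomposition 𝒜 U m n hd →
        algebraCenter 𝒜 =
          {A | ∃ α : Fin N → ℂ,
            A = (U : Matrix (Fin d) (Fin d) ℂ)ᴴ *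
              blockSum m n hd (fun i => α i • (1 : Matrix (Fin (n i)) (Fin (n i)) ℂ)) *
              (U : Matrix (Fin d) (Fin d) ℂ)}) := ⟨exists_isBlockDecomposition 𝒜, fun _ _ m n hd U h =>
    algebraCenter_eq_of_isBlockDecomposition m n hd 𝒜 U h⟩
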